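/- Let $n\in\{2,3\}$, let $B(r)\subset\mathbb R^n$ be the open ball of radius $r>0$ centred at the origin, and let $0<r_1<r_2<r_3$. Set \[ \beta:=\frac{\log r_3-\log r_2}{\log r_2-\log r_1},\qquad \alpha:=\frac{\beta}{1+\beta}=\frac{\log r_3-\log r_2}{\log r_3-\log r_1}. \] Then every (real- or complex-valued) function $u$ that is harmonic in $B(r_3)$ satisfies \[ \|u\|_{L^2(B(r_2))}\le\|u\|_{L^2(B(r_1))}^{\alpha}\,\|u\|_{L^2(B(r_3))}^{1-\alpha}, \] where the norms take values in $[0,\infty]$ and $0\cdot\infty=0$. Moreover, the exponent is sharp, for real-valued as well as for complex-valued functions: there are no $\tilde\alpha>\alpha$ and no finite constant $C$ such that \[ \|u\|_{L^2(B(r_2))}\le C\,\|u\|_{L^2(B(r_1))}^{\tilde\alpha}\,\|u\|_{L^2(B(r_3))}^{1-\tilde\alpha} \] holds for all functions $u$ that are harmonic on all of $\mathbb R^n$. In the complex-valued case this inequality fails, for every $\tilde\alpha>\alpha$ and every finite $C$, for some $u=z^k$ with an integer $k\ge 0$, where $z=x_1+ix_2$; the functions $z^k$ are harmonic on $\mathbb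 R^n$. -/

import Mathlib

open MeasureTheory InnerProductSpace
open scoped ENNReal NNReal

/-- The norm of `u` in `L²(B(r))`, where `B(r)` is the open ball of radius `r` centred at the origin
of `ℝⁿ`, as a value in `[0, ∞]`. -/
noncomputable def l2BallNorm {n : ℕ} {F : Type*} [NormedAddCommGroup F]
    (u : EuclideanSpace ℝ (Fin n) → F) (r : ℝ) : ℝ≥0∞ :=
  eLpNorm u 2 (volume.restrict (Metric.ball (0 : EuclideanSpace ℝ (Fin n)) r))

/-- The polynomial `z ^ k` on `ℝⁿ`, `n ≥ 2`, where `z = x₁ + i x₂` is formed from the first two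
coordinates of `x`. -/
noncomputable def zPow {n : ℕ} (hn : 2 ≤ n) (k : ℕ) (x : EuclideanSpace ℝ (Fin n)) : ℂ :=
  ((x ⟨0, by omega⟩ : ℂ) + Complex.I * (x ⟨1, by omega⟩ : ℂ)) ^ k

/-!
# Three balls theorem in `L²` with sharp exponent

The argument avoids expansions in spherical harmonics and works in every dimension. If `u` is
harmonic and `φ` is a radial weight supported inside the unit ball, the pairing
`⟨s, t⟩ = ∫ φ(‖x‖²) ⟪u (s x), u (t x)⟫ dx` of two dilates of `u` depends on the product `s t` only
(`radialPairing_exp_eq`). Indeed its derivative along a hyperbola `s t = m²` is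
`∫ φ(‖x‖²) (⟪x·∇v, w⟫ - ⟪v, x·∇w⟫)` for the harmonic functions `v = u (s ·)` and `w = u (t ·)`, and
the integrand is half the divergence of `Φ(‖x‖²) (⟪∇v, w⟫ - ⟪v, ∇w⟫)` with `Φ' = φ`, a compactly
supported field (`integral_radial_mul_euler_sub_eq_zero`). The Cauchy–Schwarz inequality
`⟨s, t⟩² ≤ ⟨s, s⟩ ⟨t, t⟩` therefore says that `y ↦ ⟨exp y, exp y⟩` is multiplicatively midpoint
convex; being continuous, it is logarithmically convex (`le_rpow_mul_rpow_of_midpoint_sq_le`). Letting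
`φ` increase to the indicator function of the unit ball and rescaling gives the inequality with
constant one (`l2BallNorm_le_rpow_mul_rpow`). No integrability of `u` on the largest ball is needed,
because every weight stays away from the boundary.

For sharpness, a function that is homogeneous of degree `k` has norm proportional to
`r ^ (k + n / 2)` on the ball of radius `r`, so a larger exponent would bound an unbounded geometric
sequence (`exists_not_l2BallNorm_le`). This applies to `z ^ k`, and to `Re (z ^ k)` for real values.
-/

/-! ### Green's identity with a radial weight -/

section Green

theorem laplacian_eq_sum_fderiv_fderiv {E : Type*} [NormedAddCommGroup E] [InnerProductSpace ℝ E]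
    [FiniteDimensional ℝ E] {F : Type*} [NormedAddCommGroup F] [NormedSpace ℝ F] (u : E → F)
    (x : E) :
    Laplacian.laplacian u x = ∑ i, fderiv ℝ (fderiv ℝ u) x (stdOrthonormalBasis ℝ E i)
      (stdOrthonormalBasis ℝ E i) := by
  simp [laplacian_eq_iteratedFDeriv_stdOrthonormalBasis, iteratedFDeriv_two_apply]

variable {E : Type*} [NormedAddCommGroup E] [InnerProductSpace ℝ E] [FiniteDimensional ℝ E]
  [MeasurableSpace E] [BorelSpace E]
  {F : Type*} [NormedAddCommGroup F] [InnerProductSpace ℝ F]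

theorem integral_fderiv_apply_eq_zero {g : E → ℝ} (hg : ContDiff ℝ 1 g)
    (hc : HasCompactSupport g) (v : E) : ∫ x, fderiv ℝ g x v = 0 := by
  have hd : Continuous fun x => fderiv ℝ g x v :=
    (hg.continuous_fderiv one_ne_zero).clm_apply continuous_const
  have hdc : HasCompactSupport fun x => fderiv ℝ g x v := hc.fderiv_apply ℝ v
  have h := integral_bilinear_hasLineDerivAt_right_eq_neg_left_of_integrable
    (μ := (volume : Measure E)) (f := fun _ => (1 : ℝ)) (f' := fun _ => 0) (g := g)
    (g' := fun x => fderiv ℝ g x v) (v := v) (B := ContinuousLinearMap.mul ℝ ℝ)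
    (by simp) (by simpa using hd.integrable_of_hasCompactSupport hdc)
    (by simpa using hg.continuous.integrable_of_hasCompactSupport hc)
    (fun x _ => by simpa using (hasFDerivAt_const (1 : ℝ) x).hasLineDerivAt v)
    (fun x _ => ((hg.differentiable one_ne_zero) x).hasFDerivAt.hasLineDerivAt v)
  simpa using h

/-- Green's identity against a radial weight. It is the divergence theorem for the field
`Φ(‖x‖²) (⟪∇v, w⟫ - ⟪v, ∇w⟫)`, where `Φ` is the primitive of `φ` that vanishes beyond `b`:
there is no boundary term. -/
theorem integral_radial_mul_euler_sub_eq_zero {φ : ℝ → ℝ} (hφ : Continuous φ) {b : ℝ}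
    (hb : ∀ t, b ≤ t → φ t = 0) {v w : E → F} (hv : ContDiff ℝ 2 v) (hw : ContDiff ℝ 2 w)
    (hv0 : ∀ x, ‖x‖ ^ 2 < b → Laplacian.laplacian v x = 0)
    (hw0 : ∀ x, ‖x‖ ^ 2 < b → Laplacian.laplacian w x = 0) :
    ∫ x, φ (‖x‖ ^ 2) * (⟪fderiv ℝ v x x, w x⟫_ℝ - ⟪v x, fderiv ℝ w x x⟫_ℝ) = 0 := by
  set Φ : ℝ → ℝ := fun t => ∫ r in b..t, φ r with hΦdef
  have hΦ' : ∀ t, HasDerivAt Φ (φ t) t := fun t =>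
    intervalIntegral.integral_hasDerivAt_right (hφ.intervalIntegrable _ _)
      (hφ.stronglyMeasurableAtFilter _ _) hφ.continuousAt
  have hΦC : ContDiff ℝ 1 Φ := by
    rw [contDiff_one_iff_deriv]
    refine ⟨fun t => (hΦ' t).differentiableAt, ?_⟩
    rwa [show deriv Φ = φ from funext fun t => (hΦ' t).deriv]
  have hΦ0 : ∀ t, b ≤ t → Φ t = 0 := by
    intro t ht
    simp only [hΦdef]
    rw [intervalIntegral.integral_congr (g := fun _ => (0 : ℝ))]
    · simp
    · intro r hr
      rw [Set.uIcc_of_le ht] at hr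
      exact hb r hr.1
  have hv1 : ContDiff ℝ 1 (fderiv ℝ v) := hv.fderiv_right (by norm_num)
  have hw1 : ContDiff ℝ 1 (fderiv ℝ w) := hw.fderiv_right (by norm_num)
  set e := stdOrthonormalBasis ℝ E with he
  set g : Fin (Module.finrank ℝ E) → E → ℝ := fun i x =>
    Φ (‖x‖ ^ 2) * (⟪fderiv ℝ v x (e i), w x⟫_ℝ - ⟪v x, fderiv ℝ w x (e i)⟫_ℝ) with hg
  have hΦn : ContDiff ℝ 1 fun x : E => Φ (‖x‖ ^ 2) := hΦC.comp (contDiff_norm_sq ℝ)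
  have hgC : ∀ i, ContDiff ℝ 1 (g i) := fun i =>
    hΦn.mul (((hv1.clm_apply contDiff_const).inner ℝ (hw.of_le (by norm_num))).sub
        ((hv.of_le (by norm_num)).inner ℝ (hw1.clm_apply contDiff_const)))
  have hgc : ∀ i, HasCompactSupport (g i) := by
    intro i
    refine HasCompactSupport.intro (isCompact_closedBall (0 : E) (|b| + 1)) fun x hx => ?_
    have hx' : |b| + 1 < ‖x‖ := by simpa using hx
    have : b ≤ ‖x‖ ^ 2 := by nlinarith [le_abs_self b, abs_nonneg b]
    simp [hg, hΦ0 _ this]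
  have hdiv : ∀ x, ∑ i, fderiv ℝ (g i) x (e i) =
      2 * (φ (‖x‖ ^ 2) * (⟪fderiv ℝ v x x, w x⟫_ℝ - ⟪v x, fderiv ℝ w x x⟫_ℝ)) := by
    intro x
    have hterm : ∀ i, fderiv ℝ (g i) x (e i) =
        2 * φ (‖x‖ ^ 2) * (⟪fderiv ℝ v x (⟪e i, x⟫_ℝ • e i), w x⟫_ℝ
          - ⟪v x, fderiv ℝ w x (⟪e i, x⟫_ℝ • e i)⟫_ℝ)
        + Φ (‖x‖ ^ 2) * (⟪fderiv ℝ (fderiv ℝ v) x (e i) (e i), w x⟫_ℝ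
          - ⟪v x, fderiv ℝ (fderiv ℝ w) x (e i) (e i)⟫_ℝ) := by
      intro i
      have hvx := (hv.differentiable (by norm_num) x).hasFDerivAt
      have hwx := (hw.differentiable (by norm_num) x).hasFDerivAt
      have hv2 := ((hv1.differentiable (by norm_num) x).hasFDerivAt).clm_apply
        (hasFDerivAt_const (e i) x)
      have hw2 := ((hw1.differentiable (by norm_num) x).hasFDerivAt).clm_apply
        (hasFDerivAt_const (e i) x)
      have hn := (hΦ' (‖x‖ ^ 2)).comp_hasFDerivAt x (hasStrictFDerivAt_norm_sq x).hasFDerivAt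
      have := (hn.mul ((hv2.inner ℝ hwx).sub (hvx.inner ℝ hw2))).fderiv
      have h2 : fderiv ℝ (g i) x = _ := this
      rw [h2]
      simp [fderivInnerCLM_apply, inner_smul_left, inner_smul_right, real_inner_comm]
      ring
    have hsum : ∑ i, ⟪e i, x⟫_ℝ • e i = x := e.sum_repr' x
    simp_rw [hterm]
    rw [Finset.sum_add_distrib, ← Finset.mul_sum, ← Finset.mul_sum, Finset.sum_sub_distrib,
      Finset.sum_sub_distrib, ← sum_inner, ← sum_inner, ← inner_sum, ← inner_sum, ← map_sum,
      ← map_sum, hsum, ← laplacian_eq_sum_fderiv_fderiv, ← laplacian_eq_sum_fderiv_fderiv]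
    -- The second-order part is `Φ (⟪Δv, w⟫ - ⟪v, Δw⟫)`: inside `Δv = Δw = 0`, outside `Φ = 0`.
    rcases lt_or_ge (‖x‖ ^ 2) b with hx | hx
    · rw [hv0 x hx, hw0 x hx]; simp; ring
    · rw [hΦ0 _ hx]; ring
  have hzero : ∫ x, ∑ i, fderiv ℝ (g i) x (e i) = 0 := by
    rw [integral_finsetSum]
    · exact Finset.sum_eq_zero fun i _ => integral_fderiv_apply_eq_zero (hgC i) (hgc i) _
    · intro i _
      exact (((hgC i).continuous_fderiv one_ne_zero).clm_apply
        continuous_const).integrable_of_hasCompactSupport ((hgc i).fderiv_apply ℝ _)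
  simp_rw [hdiv] at hzero
  rw [integral_const_mul] at hzero
  linarith

end Green

/-! ### Pairing of dilates -/

section RadialPairing

theorem hasDerivAt_integral_of_continuous_of_isCompact {E : Type*} [TopologicalSpace E]
    [MeasurableSpace E] [OpensMeasurableSpace E] [SecondCountableTopology E]
    {μ : Measure E} [IsFiniteMeasureOnCompacts μ] [T2Space E] {f f' : ℝ → E → ℝ} {K : Set E}
    (hK : IsCompact K) (hf : Continuous f.uncurry) (hf' : Continuous f'.uncurry)
    (hfK : ∀ τ, ∀ x ∉ K, f τ x = 0) (hfK' : ∀ τ, ∀ x ∉ K, f' τ x = 0)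
    (hd : ∀ τ x, HasDerivAt (f · x) (f' τ x) τ) (τ : ℝ) :
    HasDerivAt (fun τ => ∫ x, f τ x ∂μ) (∫ x, f' τ x ∂μ) τ := by
  obtain ⟨C, hC⟩ := ((isCompact_closedBall τ 1).prod hK).exists_bound_of_continuousOn
    hf'.continuousOn
  have hc : ∀ τ, Continuous (f τ) := fun τ => hf.comp (Continuous.prodMk_right τ)
  have hc' : ∀ τ, Continuous (f' τ) := fun τ => hf'.comp (Continuous.prodMk_right τ)
  refine (hasDerivAt_integral_of_dominated_loc_of_deriv_le (F := f) (F' := f')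
    (bound := K.indicator fun _ => C) (Metric.closedBall_mem_nhds τ one_pos)
    (.of_forall fun τ => (hc τ).aestronglyMeasurable)
    ((hc τ).integrable_of_hasCompactSupport (HasCompactSupport.intro hK (hfK τ)))
    (hc' τ).aestronglyMeasurable (.of_forall fun x σ hσ => ?_) ?_
    (.of_forall fun x σ _ => hd σ x)).2
  · by_cases hx : x ∈ K
    · simpa [hx] using hC (σ, x) ⟨hσ, hx⟩
    · simp [hx, hfK' σ x hx]
  · rw [integrable_indicator_iff hK.measurableSet]
    exact integrableOn_const (hK.measure_lt_top.ne)

variable {E : Type*} [NormedAddCommGroup E] [InnerProductSpace ℝ E] [FiniteDimensional ℝ E]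
  [MeasurableSpace E] [BorelSpace E]
  {F : Type*} [NormedAddCommGroup F] [InnerProductSpace ℝ F]

/-- The `L²` pairing of the two dilates `x ↦ u (s x)` and `x ↦ u (t x)` of `u`, taken with the radial
weight `φ (‖x‖²)`. -/
noncomputable def radialPairing (φ : ℝ → ℝ) (u : E → F) (s t : ℝ) : ℝ :=
  ∫ x, φ (‖x‖ ^ 2) * ⟪u (s • x), u (t • x)⟫_ℝ

theorem eq_zero_of_notMem_closedBall {E : Type*} [NormedAddCommGroup E] {φ : ℝ → ℝ}
    {b : ℝ} (hb : ∀ t, b ≤ t → φ t = 0) {x : E}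
    (hx : x ∉ Metric.closedBall (0 : E) (|b| + 1)) : φ (‖x‖ ^ 2) = 0 := by
  have hx' : |b| + 1 < ‖x‖ := by simpa using hx
  exact hb _ (by nlinarith [le_abs_self b, abs_nonneg b])

theorem continuous_radialPairing_comp {φ : ℝ → ℝ} (hφ : Continuous φ) {b : ℝ}
    (hb : ∀ t, b ≤ t → φ t = 0) {u : E → F} (hu : Continuous u) {s t : ℝ → ℝ}
    (hs : Continuous s) (ht : Continuous t) :
    Continuous fun τ => radialPairing φ u (s τ) (t τ) := by
  have h := continuous_parametric_integral_of_continuous (μ := (volume : Measure E))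
    (f := fun (τ : ℝ) (x : E) => φ (‖x‖ ^ 2) * ⟪u (s τ • x), u (t τ • x)⟫_ℝ) (by fun_prop)
    (isCompact_closedBall (0 : E) (|b| + 1))
  refine h.congr fun τ => ?_
  rw [radialPairing, setIntegral_eq_integral_of_forall_compl_eq_zero]
  intro x hx
  rw [eq_zero_of_notMem_closedBall hb hx, zero_mul]

theorem fderiv_comp_smul_apply_self {E F : Type*} [NormedAddCommGroup E]
    [NormedSpace ℝ E] [NormedAddCommGroup F] [NormedSpace ℝ F] {u : E → F}
    (hu : Differentiable ℝ u) (s : ℝ) (x : E) :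
    fderiv ℝ (fun x => u (s • x)) x x = fderiv ℝ u (s • x) (s • x) := by
  have h := (hu (s • x)).hasFDerivAt.comp x ((hasFDerivAt_id (𝕜 := ℝ) x).const_smul s)
  have h2 : fderiv ℝ (fun x => u (s • x)) x = _ := h.fderiv
  rw [h2]; simp

theorem laplacian_comp_smul {E F : Type*} [NormedAddCommGroup E] [InnerProductSpace ℝ E]
    [FiniteDimensional ℝ E] [NormedAddCommGroup F] [NormedSpace ℝ F] {u : E → F}
    (hu : ContDiff ℝ 2 u) (s : ℝ) (x : E) :
    Laplacian.laplacian (fun x => u (s • x)) x = s ^ 2 • Laplacian.laplacian u (s • x) := by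
  have h := fun x => (s • ContinuousLinearMap.id ℝ E).iteratedFDeriv_comp_right hu x
    (i := 2) le_rfl
  have hc : (fun x => u (s • x)) = u ∘ (s • ContinuousLinearMap.id ℝ E) := by ext; simp
  rw [hc, laplacian_eq_iteratedFDeriv_stdOrthonormalBasis,
    laplacian_eq_iteratedFDeriv_stdOrthonormalBasis, Finset.smul_sum]
  refine Finset.sum_congr rfl fun i _ => ?_
  rw [h]
  simp [iteratedFDeriv_two_apply, smul_smul, sq]

/-- The pairing is constant along the hyperbola `s t = m²`, because its derivative in the direction
of the hyperbola is the integral in Green's identity. -/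
theorem radialPairing_exp_eq {φ : ℝ → ℝ} (hφ : Continuous φ) {b : ℝ}
    (hb : ∀ t, b ≤ t → φ t = 0) {u : E → F} (hu : ContDiff ℝ 2 u) {R : ℝ}
    (hu0 : ∀ x, ‖x‖ < R * √b → Laplacian.laplacian u x = 0) {p q : ℝ}
    (hp : Real.exp p ≤ R) (hq : Real.exp q ≤ R) :
    radialPairing φ u (Real.exp p) (Real.exp q) =
      radialPairing φ u (Real.exp ((p + q) / 2)) (Real.exp ((p + q) / 2)) := by
  set s : ℝ → ℝ := fun τ => Real.exp ((p + q) / 2 + τ) with hs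
  set t : ℝ → ℝ := fun τ => Real.exp ((p + q) / 2 - τ) with ht
  have hud : Differentiable ℝ u := hu.differentiable (by norm_num)
  have hu1 : Continuous (fderiv ℝ u) := hu.continuous_fderiv (by norm_num)
  have huc : Continuous u := hu.continuous
  have hsd : ∀ τ, HasDerivAt s (s τ) τ := fun τ => by
    simpa using ((hasDerivAt_id τ).const_add ((p + q) / 2)).exp
  have htd : ∀ τ, HasDerivAt t (-t τ) τ := fun τ => by
    simpa using ((hasDerivAt_id τ).const_sub ((p + q) / 2)).exp
  have hsc : Continuous s := by fun_prop
  have htc : Continuous t := by fun_prop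
  have hder : ∀ τ, HasDerivAt (fun τ => radialPairing φ u (s τ) (t τ))
      (∫ x, φ (‖x‖ ^ 2) * (⟪fderiv ℝ u (s τ • x) (s τ • x), u (t τ • x)⟫_ℝ
        - ⟪u (s τ • x), fderiv ℝ u (t τ • x) (t τ • x)⟫_ℝ)) τ := by
    refine hasDerivAt_integral_of_continuous_of_isCompact
      (isCompact_closedBall (0 : E) (|b| + 1)) (f := fun τ x => _) (f' := fun τ x => _)
      ?_ ?_ ?_ ?_ ?_
    · simp only [Function.uncurry_def]; fun_prop
    · simp only [Function.uncurry_def]; fun_prop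
    · intro τ x hx
      simp only [eq_zero_of_notMem_closedBall hb hx, zero_mul]
    · intro τ x hx
      simp only [eq_zero_of_notMem_closedBall hb hx, zero_mul]
    · intro τ x
      have h1 : HasDerivAt (fun τ => u (s τ • x)) (fderiv ℝ u (s τ • x) (s τ • x)) τ :=
        (hud _).hasFDerivAt.comp_hasDerivAt τ ((hsd τ).smul_const x)
      have h2 : HasDerivAt (fun τ => u (t τ • x)) (fderiv ℝ u (t τ • x) (-t τ • x)) τ :=
        (hud _).hasFDerivAt.comp_hasDerivAt τ ((htd τ).smul_const x)
      refine ((h1.inner ℝ h2).const_mul (φ (‖x‖ ^ 2))).congr_deriv ?_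
      rw [neg_smul, map_neg, inner_neg_right]
      ring
  have hharm : ∀ r, 0 < r → r ≤ R → ∀ x : E, ‖x‖ ^ 2 < b →
      Laplacian.laplacian (fun x => u (r • x)) x = 0 := by
    intro r hr hrR x hx
    rw [laplacian_comp_smul hu, hu0, smul_zero]
    rw [norm_smul, Real.norm_of_nonneg hr.le]
    have : ‖x‖ < √b := Real.lt_sqrt_of_sq_lt hx
    calc r * ‖x‖ < r * √b := by gcongr
      _ ≤ R * √b := by gcongr
  have hder0 : ∀ τ, s τ ≤ R → t τ ≤ R →
      HasDerivAt (fun τ => radialPairing φ u (s τ) (t τ)) 0 τ := by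
    intro τ h1 h2
    convert hder τ
    have h := integral_radial_mul_euler_sub_eq_zero hφ hb
      (v := fun x => u (s τ • x)) (w := fun x => u (t τ • x)) (hu.comp (contDiff_const_smul _))
      (hu.comp (contDiff_const_smul _)) (hharm _ (Real.exp_pos _) h1) (hharm _ (Real.exp_pos _) h2)
    simp_rw [fderiv_comp_smul_apply_self hud] at h
    exact h.symm
  have hbd : ∀ τ ∈ Set.uIcc 0 ((p - q) / 2), s τ ≤ R ∧ t τ ≤ R := by
    intro τ hτ
    have hmax : Real.exp (max p q) ≤ R := by
      rcases max_choice p q with h | h <;> rw [h] <;> assumption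
    constructor <;> refine le_trans (Real.exp_le_exp.2 ?_) hmax <;>
      rcases Set.mem_uIcc.1 hτ with h | h
    · exact le_max_of_le_left (by linarith)
    · exact le_max_of_le_right (by linarith)
    · exact le_max_of_le_left (by linarith)
    · exact le_max_of_le_right (by linarith)
  have hconst := (convex_uIcc (0 : ℝ) ((p - q) / 2)).norm_image_sub_le_of_norm_hasDerivWithin_le
    (C := 0) (fun τ hτ => (hder0 τ (hbd τ hτ).1 (hbd τ hτ).2).hasDerivWithinAt) (by simp)
    Set.left_mem_uIcc Set.right_mem_uIcc
  rw [zero_mul, norm_le_zero_iff, sub_eq_zero] at hconst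
  have e1 : s ((p - q) / 2) = Real.exp p := by simp only [hs]; congr 1; ring
  have e2 : t ((p - q) / 2) = Real.exp q := by simp only [ht]; congr 1; ring
  have e3 : s 0 = Real.exp ((p + q) / 2) := by simp [hs]
  have e4 : t 0 = Real.exp ((p + q) / 2) := by simp [ht]
  rwa [e1, e2, e3, e4] at hconst

/-- The Cauchy–Schwarz inequality for the weighted pairing of the two dilates. -/
theorem radialPairing_sq_le {φ : ℝ → ℝ} (hφ : Continuous φ) (hφ0 : ∀ t, 0 ≤ φ t) {b : ℝ}
    (hb : ∀ t, b ≤ t → φ t = 0) {u : E → F} (hu : Continuous u) (s t : ℝ) :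
    radialPairing φ u s t ^ 2 ≤ radialPairing φ u s s * radialPairing φ u t t := by
  have hint : ∀ s t : ℝ, Integrable fun x => φ (‖x‖ ^ 2) * ⟪u (s • x), u (t • x)⟫_ℝ := fun s t =>
    Continuous.integrable_of_hasCompactSupport (by fun_prop)
      (HasCompactSupport.intro (isCompact_closedBall (0 : E) (|b| + 1)) fun x hx => by
        rw [eq_zero_of_notMem_closedBall hb hx, zero_mul])
  have key : ∀ c : ℝ, 0 ≤ radialPairing φ u s s * (c * c) + 2 * radialPairing φ u s t * c
      + radialPairing φ u t t := by
    intro c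
    have h : 0 ≤ ∫ x, φ (‖x‖ ^ 2) * ‖c • u (s • x) + u (t • x)‖ ^ 2 :=
      integral_nonneg fun x => mul_nonneg (hφ0 _) (sq_nonneg _)
    have he : ∀ x, φ (‖x‖ ^ 2) * ‖c • u (s • x) + u (t • x)‖ ^ 2 =
        c * c * (φ (‖x‖ ^ 2) * ⟪u (s • x), u (s • x)⟫_ℝ)
          + 2 * c * (φ (‖x‖ ^ 2) * ⟪u (s • x), u (t • x)⟫_ℝ)
          + φ (‖x‖ ^ 2) * ⟪u (t • x), u (t • x)⟫_ℝ := by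
      intro x
      rw [norm_add_sq_real, norm_smul, mul_pow, Real.norm_eq_abs, sq_abs, real_inner_smul_left,
        real_inner_self_eq_norm_sq (u _), real_inner_self_eq_norm_sq (u _)]
      ring
    simp_rw [he] at h
    rw [integral_add (Integrable.fun_add ((hint s s).const_mul _) ((hint s t).const_mul _))
      (hint t t), integral_add ((hint s s).const_mul _) ((hint s t).const_mul _), integral_const_mul,
      integral_const_mul] at h
    simp only [radialPairing]
    linarith
  have := discrim_le_zero key
  rw [discrim] at this
  nlinarith

end RadialPairing

/-! ### Midpoint convexity -/

/-- A nonnegative continuous function `k` with `k ((x + y) / 2) ^ 2 ≤ k x * k y` which is at most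
`1` at the endpoints of an interval is at most `1` inside. Otherwise its maximum, attained at a
leftmost point, would violate the inequality around that point. -/
theorem le_one_of_midpoint_sq_le {k : ℝ → ℝ} {a c : ℝ} (hk : Continuous k)
    (hk0 : ∀ x, 0 ≤ k x)
    (hmid : ∀ x ∈ Set.Icc a c, ∀ y ∈ Set.Icc a c, k ((x + y) / 2) ^ 2 ≤ k x * k y)
    (ha : k a ≤ 1) (hc : k c ≤ 1) {x : ℝ} (hx : x ∈ Set.Icc a c) : k x ≤ 1 := by
  by_contra! hlt
  obtain ⟨z, hz, hzmax⟩ := isCompact_Icc.exists_isMaxOn ⟨x, hx⟩ hk.continuousOn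
  have hz1 : 1 < k z := hlt.trans_le (hzmax hx)
  have hS : IsCompact (Set.Icc a c ∩ k ⁻¹' {k z}) :=
    isCompact_Icc.inter_right (isClosed_singleton.preimage hk)
  obtain ⟨m, ⟨hm, hmz⟩, hmin⟩ := hS.exists_isLeast ⟨z, hz, rfl⟩
  have hmz' : k m = k z := hmz
  have ham : a < m := lt_of_le_of_ne hm.1 fun h => by rw [← h] at hmz'; linarith
  have hmc : m < c := lt_of_le_of_ne hm.2 fun h => by rw [h] at hmz'; linarith
  set δ := min (m - a) (c - m) with hδ
  have hδ0 : 0 < δ := lt_min (by linarith) (by linarith)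
  have hδ1 : δ ≤ m - a := min_le_left _ _
  have hδ2 : δ ≤ c - m := min_le_right _ _
  have hl : m - δ ∈ Set.Icc a c := ⟨by linarith, by linarith⟩
  have hr : m + δ ∈ Set.Icc a c := ⟨by linarith, by linarith⟩
  have h1 : k (m - δ) < k z := lt_of_le_of_ne (hzmax hl) fun h => by
    have := hmin ⟨hl, h⟩
    linarith
  have h2 : k (m + δ) ≤ k z := hzmax hr
  have h3 := hmid _ hl _ hr
  rw [show (m - δ + (m + δ)) / 2 = m by ring, hmz'] at h3
  nlinarith [hk0 (m - δ), hk0 (m + δ)]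

/-- Continuous multiplicatively midpoint-convex functions are log-convex. Values `0` are allowed. -/
theorem le_rpow_mul_rpow_of_midpoint_sq_le {g : ℝ → ℝ} {a c : ℝ} (hg : Continuous g)
    (hg0 : ∀ x, 0 ≤ g x)
    (hmid : ∀ x ∈ Set.Icc a c, ∀ y ∈ Set.Icc a c, g ((x + y) / 2) ^ 2 ≤ g x * g y)
    (hac : a ≤ c) {θ : ℝ} (hθ0 : 0 < θ) (hθ1 : θ < 1) :
    g (θ * a + (1 - θ) * c) ≤ g a ^ θ * g c ^ (1 - θ) := by
  -- `A` and `B` are arbitrary positive upper bounds for the endpoint values; dividing by the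
  -- log-affine function through `A` and `B` reduces to the bound by one.
  have main : ∀ A B : ℝ, 0 < A → 0 < B → g a ≤ A → g c ≤ B →
      g (θ * a + (1 - θ) * c) ≤ A ^ θ * B ^ (1 - θ) := by
    intro A B hA hB hgA hgB
    rcases hac.eq_or_lt with rfl | hac
    · have h1 : θ * a + (1 - θ) * a = a := by ring
      rw [h1]
      have h2 : 0 ≤ g a := hg0 a
      calc g a = g a ^ θ * g a ^ (1 - θ) := by
            rw [← Real.rpow_add_of_nonneg h2 hθ0.le (by linarith)]; simp
        _ ≤ _ := by
            gcongr
    set l : ℝ → ℝ := fun x => ((c - x) * Real.log A + (x - a) * Real.log B) / (c - a) with hl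
    have hca : c - a ≠ 0 := by linarith
    have hla : l a = Real.log A := by simp only [hl]; field_simp; ring
    have hlc : l c = Real.log B := by simp only [hl]; field_simp; ring
    have hlm : l (θ * a + (1 - θ) * c) = Real.log A * θ + Real.log B * (1 - θ) := by
      simp only [hl]; field_simp; ring
    have hpt : θ * a + (1 - θ) * c ∈ Set.Icc a c := ⟨by nlinarith, by nlinarith⟩
    have := le_one_of_midpoint_sq_le (k := fun x => g x * Real.exp (-l x)) (a := a) (c := c)
      (by fun_prop) (fun x => mul_nonneg (hg0 x) (Real.exp_pos _).le) ?_ ?_ ?_ hpt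
    · rw [Real.exp_neg, ← div_eq_mul_inv, div_le_one (Real.exp_pos _), hlm, Real.exp_add,
        ← Real.rpow_def_of_pos hA, ← Real.rpow_def_of_pos hB] at this
      exact this
    · intro x hx y hy
      have hexp : Real.exp (-l ((x + y) / 2)) ^ 2 = Real.exp (-l x) * Real.exp (-l y) := by
        rw [← Real.exp_nat_mul, ← Real.exp_add]
        congr 1
        simp only [hl]; push_cast; field_simp; ring
      rw [mul_pow, hexp]
      calc _ ≤ g x * g y * (Real.exp (-l x) * Real.exp (-l y)) := by
            gcongr; exact hmid x hx y hy
        _ = _ := by ring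
    · rw [Real.exp_neg, ← div_eq_mul_inv, div_le_one (Real.exp_pos _), hla, Real.exp_log hA]
      exact hgA
    · rw [Real.exp_neg, ← div_eq_mul_inv, div_le_one (Real.exp_pos _), hlc, Real.exp_log hB]
      exact hgB
  -- Adding `ε` makes the endpoint values positive; then let `ε` tend to `0`.
  have hlim : Filter.Tendsto (fun ε : ℝ => (g a + ε) ^ θ * (g c + ε) ^ (1 - θ))
      (nhdsWithin 0 (Set.Ioi 0)) (nhds (g a ^ θ * g c ^ (1 - θ))) := by
    have hcont : Continuous fun ε : ℝ => (g a + ε) ^ θ * (g c + ε) ^ (1 - θ) :=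
      ((continuous_const.add continuous_id).rpow_const fun _ => Or.inr hθ0.le).mul
        ((continuous_const.add continuous_id).rpow_const fun _ => Or.inr (by linarith))
    simpa using (hcont.tendsto 0).mono_left nhdsWithin_le_nhds
  refine ge_of_tendsto hlim ?_
  filter_upwards [self_mem_nhdsWithin] with ε hε
  have hε' : 0 < ε := hε
  exact main _ _ (by linarith [hg0 a]) (by linarith [hg0 c]) (by linarith) (by linarith)

/-! ### Dilation of `L²` norms on balls -/

theorem l2BallNorm_eq {n : ℕ} {F : Type*} [NormedAddCommGroup F] (u : EuclideanSpace ℝ (Fin n) → F)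
    (r : ℝ) : l2BallNorm u r = (∫⁻ x in Metric.ball 0 r, ‖u x‖ₑ ^ (2 : ℝ)) ^ (1 / 2 : ℝ) := by
  rw [l2BallNorm, eLpNorm_eq_lintegral_rpow_enorm_toReal (by norm_num) (by norm_num)]
  simp

theorem l2BallNorm_eq_mul_comp_smul {n : ℕ} {F : Type*} [NormedAddCommGroup F]
    (u : EuclideanSpace ℝ (Fin n) → F) {r : ℝ} (hr : 0 < r) :
    l2BallNorm u r = ENNReal.ofReal (r ^ ((n : ℝ) / 2)) * l2BallNorm (fun x => u (r • x)) 1 := by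
  have hscale : ∫⁻ x in Metric.ball 0 r, ‖u x‖ₑ ^ (2 : ℝ) =
      ENNReal.ofReal (r ^ n) * ∫⁻ x in Metric.ball 0 1, ‖u (r • x)‖ₑ ^ (2 : ℝ) := by
    have hmap := lintegral_map_equiv (μ := volume)
      ((Metric.ball (0 : EuclideanSpace ℝ (Fin n)) r).indicator fun x => ‖u x‖ₑ ^ (2 : ℝ))
      (Homeomorph.smulOfNeZero r hr.ne').toMeasurableEquiv
    have hm := Measure.map_addHaar_smul (volume : Measure (EuclideanSpace ℝ (Fin n))) hr.ne'
    have hcoe : ⇑(Homeomorph.smulOfNeZero (α := EuclideanSpace ℝ (Fin n)) r hr.ne').toMeasurableEquiv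
      = (r • ·) := rfl
    rw [hcoe, hm, lintegral_smul_measure, finrank_euclideanSpace_fin,
      lintegral_indicator Metric.isOpen_ball.measurableSet] at hmap
    have hind : ∀ x : EuclideanSpace ℝ (Fin n),
        (Metric.ball (0 : EuclideanSpace ℝ (Fin n)) r).indicator (fun x => ‖u x‖ₑ ^ (2 : ℝ)) (r • x)
        = (Metric.ball (0 : EuclideanSpace ℝ (Fin n)) 1).indicator
          (fun x => ‖u (r • x)‖ₑ ^ (2 : ℝ)) x := by
      intro x
      have : r • x ∈ Metric.ball (0 : EuclideanSpace ℝ (Fin n)) r ↔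
          x ∈ Metric.ball (0 : EuclideanSpace ℝ (Fin n)) 1 := by
        simp only [mem_ball_zero_iff, norm_smul, Real.norm_of_nonneg hr.le]
        exact mul_lt_iff_lt_one_right hr
      by_cases hx : x ∈ Metric.ball (0 : EuclideanSpace ℝ (Fin n)) 1
      · rw [Set.indicator_of_mem hx, Set.indicator_of_mem (this.2 hx)]
      · rw [Set.indicator_of_notMem hx, Set.indicator_of_notMem (mt this.1 hx)]
    simp_rw [hind] at hmap
    rw [lintegral_indicator Metric.isOpen_ball.measurableSet] at hmap
    rw [← hmap, smul_eq_mul, ← mul_assoc, ← ENNReal.ofReal_mul (by positivity),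
      abs_of_pos (by positivity), mul_inv_cancel₀ (by positivity), ENNReal.ofReal_one, one_mul]
  rw [l2BallNorm_eq, l2BallNorm_eq, hscale, ENNReal.mul_rpow_of_nonneg _ _ (by norm_num),
    ENNReal.ofReal_rpow_of_pos (by positivity), ← Real.rpow_natCast_mul hr.le]
  congr 4
  ring

/-! ### The three-ball inequality -/

section ThreeBalls

variable {E : Type*} [NormedAddCommGroup E] [InnerProductSpace ℝ E] [FiniteDimensional ℝ E]
  {F : Type*} [NormedAddCommGroup F] [InnerProductSpace ℝ F]

theorem exists_contDiff_eventuallyEq_of_contDiffOn_ball {u : E → F} {R r : ℝ} (hR : 0 < R)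
    (hRr : R < r) (hu : ContDiffOn ℝ 2 u (Metric.ball 0 r)) :
    ∃ v : E → F, ContDiff ℝ 2 v ∧ ∀ x, ‖x‖ < R → v =ᶠ[nhds x] u := by
  let χ : ContDiffBump (0 : E) := ⟨R, (R + r) / 2, hR, by linarith⟩
  refine ⟨fun x => χ x • u x, contDiff_iff_contDiffAt.2 fun x => ?_, fun x hx => ?_⟩
  · by_cases hx : x ∈ Metric.ball (0 : E) r
    · exact χ.contDiffAt.smul (hu.contDiffAt (Metric.isOpen_ball.mem_nhds hx))
    · have hx' : x ∉ tsupport χ := by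
        rw [χ.tsupport_eq]
        simp only [Metric.mem_ball, Metric.mem_closedBall, dist_zero_right] at hx ⊢
        change ¬ ‖x‖ ≤ (R + r) / 2
        linarith
      have h0 : (fun x => χ x • u x) =ᶠ[nhds x] fun _ => 0 := by
        filter_upwards [notMem_tsupport_iff_eventuallyEq.1 hx'] with y hy
        simp [hy]
      exact contDiffAt_const.congr_of_eventuallyEq h0
  · filter_upwards [χ.eventuallyEq_one_of_mem_ball (x := x) (by simpa using hx)] with y hy
    simp [hy]

/-- A piecewise linear function with values in `[0, 1]` that vanishes for `t ≥ 1 - 1 / (j + 2)`. As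
`j` grows it increases to the indicator function of `t < 1`. -/
noncomputable def cutoff (j : ℕ) (t : ℝ) : ℝ := max 0 (min 1 ((j + 2) * (1 - t) - 1))

theorem continuous_cutoff (j : ℕ) : Continuous (cutoff j) := by
  unfold cutoff; fun_prop

theorem cutoff_nonneg (j : ℕ) (t : ℝ) : 0 ≤ cutoff j t := le_max_left _ _

theorem cutoff_eq_zero {j : ℕ} {t : ℝ} (ht : 1 - 1 / ((j : ℝ) + 2) ≤ t) : cutoff j t = 0 := by
  have hj : (0 : ℝ) < j + 2 := by positivity
  have h : ((j : ℝ) + 2) * (1 - t) ≤ 1 := by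
    calc ((j : ℝ) + 2) * (1 - t) ≤ (j + 2) * (1 / (j + 2)) := by gcongr; linarith
      _ = 1 := by field_simp
  exact max_eq_left ((min_le_right _ _).trans (by linarith))

theorem cutoff_mono (t : ℝ) : Monotone fun j => cutoff j t := by
  intro i j hij
  have hij' : (i : ℝ) ≤ j := by exact_mod_cast hij
  rcases le_or_gt 1 t with ht | ht
  · have h : ∀ k : ℕ, cutoff k t = 0 := fun k => cutoff_eq_zero
      ((sub_le_self 1 (by positivity)).trans ht)
    simp [h]
  · have : (0 : ℝ) ≤ 1 - t := by linarith
    simp only [cutoff]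
    gcongr

theorem iSup_ofReal_cutoff (t : ℝ) :
    ⨆ j, ENNReal.ofReal (cutoff j t) = if t < 1 then 1 else 0 := by
  split_ifs with ht
  · refine le_antisymm (iSup_le fun j => ?_) ?_
    · rw [ENNReal.ofReal_le_one]
      exact max_le zero_le_one (min_le_left _ _)
    · obtain ⟨j, hj⟩ := exists_nat_gt (2 / (1 - t))
      refine le_iSup_of_le j ?_
      have : (1 : ℝ) ≤ (j + 2) * (1 - t) - 1 := by
        rw [div_lt_iff₀ (by linarith)] at hj
        nlinarith
      simp [cutoff, min_eq_left this]
  · have h : ∀ k : ℕ, cutoff k t = 0 := fun k => cutoff_eq_zero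
      ((sub_le_self 1 (by positivity)).trans (not_lt.1 ht))
    simp [h]

variable [MeasurableSpace E] [BorelSpace E]

/-- The logarithmic convexity for a radial weight supported in a ball of radius `√b < 1`. There, the
harmonic function may be replaced by a global `C²` function. The measurability of the integrand is
recorded for the passage to the limit of weights. -/
theorem lintegral_radial_mul_le {u : E → F} {r₁ r₂ r₃ α : ℝ} (h₁ : 0 < r₁) (h₁₃ : r₁ ≤ r₃)
    (hu : HarmonicOnNhd u (Metric.ball 0 r₃)) (hα0 : 0 < α) (hα1 : α < 1)
    (hr : Real.log r₂ = α * Real.log r₁ + (1 - α) * Real.log r₃) (h₂ : 0 < r₂)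
    {φ : ℝ → ℝ} (hφ : Continuous φ) (hφ0 : ∀ t, 0 ≤ φ t) {b : ℝ} (hb0 : 0 < b) (hb1 : b < 1)
    (hb : ∀ t, b ≤ t → φ t = 0) :
    (∀ r, 0 < r → r ≤ r₃ → Measurable fun x : E =>
      ENNReal.ofReal (φ (‖x‖ ^ 2)) * ‖u (r • x)‖ₑ ^ (2 : ℝ)) ∧
    ∫⁻ x, ENNReal.ofReal (φ (‖x‖ ^ 2)) * ‖u (r₂ • x)‖ₑ ^ (2 : ℝ) ≤
      (∫⁻ x, ENNReal.ofReal (φ (‖x‖ ^ 2)) * ‖u (r₁ • x)‖ₑ ^ (2 : ℝ)) ^ α *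
      (∫⁻ x, ENNReal.ofReal (φ (‖x‖ ^ 2)) * ‖u (r₃ • x)‖ₑ ^ (2 : ℝ)) ^ (1 - α) := by
  have h₃ : 0 < r₃ := h₁.trans_le h₁₃
  have hsb : √b < 1 := by rw [Real.sqrt_lt' one_pos]; simpa using hb1
  have hsb0 : 0 < √b := Real.sqrt_pos.2 hb0
  obtain ⟨v, hv, hvu⟩ := exists_contDiff_eventuallyEq_of_contDiffOn_ball (R := r₃ * √b)
    (by positivity) (by nlinarith) hu.contDiffOn
  have hv0 : ∀ x, ‖x‖ < r₃ * √b → Laplacian.laplacian v x = 0 := by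
    intro x hx
    rw [(laplacian_congr_nhds (hvu x hx)).eq_of_nhds]
    refine (hu x ?_).2.eq_of_nhds
    rw [mem_ball_zero_iff]
    nlinarith
  have hvc : Continuous v := hv.continuous
  have hcont : ∀ r : ℝ, Continuous fun x => φ (‖x‖ ^ 2) * ⟪v (r • x), v (r • x)⟫_ℝ := fun r => by
    fun_prop
  have hpt : ∀ r, 0 < r → r ≤ r₃ → ∀ x : E,
      ENNReal.ofReal (φ (‖x‖ ^ 2)) * ‖u (r • x)‖ₑ ^ (2 : ℝ) =
        ENNReal.ofReal (φ (‖x‖ ^ 2) * ⟪v (r • x), v (r • x)⟫_ℝ) := by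
    intro r hr0 hr3 x
    rcases lt_or_ge (‖x‖ ^ 2) b with hx | hx
    · have hx' : ‖r • x‖ < r₃ * √b := by
        rw [norm_smul, Real.norm_of_nonneg hr0.le]
        have : ‖x‖ < √b := Real.lt_sqrt_of_sq_lt hx
        calc r * ‖x‖ < r * √b := by gcongr
          _ ≤ r₃ * √b := by gcongr
      rw [(hvu _ hx').eq_of_nhds, ENNReal.ofReal_mul (hφ0 _), real_inner_self_eq_norm_sq,
        ENNReal.ofReal_pow (norm_nonneg _), ofReal_norm]
      norm_num
    · simp [hb _ hx]
  have hint : ∀ r, 0 < r → r ≤ r₃ →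
      ∫⁻ x, ENNReal.ofReal (φ (‖x‖ ^ 2)) * ‖u (r • x)‖ₑ ^ (2 : ℝ) =
        ENNReal.ofReal (radialPairing φ v r r) := by
    intro r hr0 hr3
    rw [radialPairing, ofReal_integral_eq_lintegral_ofReal]
    · exact lintegral_congr fun x => hpt r hr0 hr3 x
    · exact (hcont r).integrable_of_hasCompactSupport
        (HasCompactSupport.intro (isCompact_closedBall (0 : E) (|b| + 1)) fun x hx => by
          rw [eq_zero_of_notMem_closedBall hb hx, zero_mul])
    · exact .of_forall fun x => mul_nonneg (hφ0 _) real_inner_self_nonneg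
  have hl13 : Real.log r₁ ≤ Real.log r₃ := Real.log_le_log h₁ h₁₃
  have h₂₃ : r₂ ≤ r₃ := by
    rw [← Real.log_le_log_iff h₂ h₃]
    nlinarith
  refine ⟨fun r hr0 hr3 => ?_, ?_⟩
  · simp_rw [hpt r hr0 hr3]
    exact (hcont r).measurable.ennreal_ofReal
  · have hnn : ∀ r, 0 ≤ radialPairing φ v r r := fun r =>
      integral_nonneg fun x => mul_nonneg (hφ0 _) real_inner_self_nonneg
    have hle : ∀ x ∈ Set.Icc (Real.log r₁) (Real.log r₃), Real.exp x ≤ r₃ := fun x hx =>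
      (Real.le_log_iff_exp_le h₃).1 hx.2
    have key := le_rpow_mul_rpow_of_midpoint_sq_le
      (g := fun y => radialPairing φ v (Real.exp y) (Real.exp y))
      (continuous_radialPairing_comp hφ hb hvc Real.continuous_exp Real.continuous_exp)
      (fun y => hnn _) (fun x hx y hy => by
        rw [← radialPairing_exp_eq hφ hb hv hv0 (hle x hx) (hle y hy)]
        exact radialPairing_sq_le hφ hφ0 hb hvc _ _) hl13 hα0 hα1
    simp only [← hr, Real.exp_log h₁, Real.exp_log h₂, Real.exp_log h₃] at key
    rw [hint _ h₁ h₁₃, hint _ h₂ h₂₃, hint _ h₃ le_rfl,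
      ENNReal.ofReal_rpow_of_nonneg (hnn _) hα0.le,
      ENNReal.ofReal_rpow_of_nonneg (hnn _) (by linarith), ← ENNReal.ofReal_mul (by
        have := hnn r₁; positivity)]
    exact ENNReal.ofReal_le_ofReal key

/-- The three-ball inequality for the dilates of a harmonic function, integrated over the unit ball.
By monotone convergence it needs no finiteness of the integrals. -/
theorem setLIntegral_ball_le {u : E → F} {r₁ r₂ r₃ α : ℝ} (h₁ : 0 < r₁) (h₁₃ : r₁ ≤ r₃)
    (hu : HarmonicOnNhd u (Metric.ball 0 r₃)) (hα0 : 0 < α) (hα1 : α < 1)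
    (hr : Real.log r₂ = α * Real.log r₁ + (1 - α) * Real.log r₃) (h₂ : 0 < r₂) :
    ∫⁻ x in Metric.ball 0 1, ‖u (r₂ • x)‖ₑ ^ (2 : ℝ) ≤
      (∫⁻ x in Metric.ball 0 1, ‖u (r₁ • x)‖ₑ ^ (2 : ℝ)) ^ α *
      (∫⁻ x in Metric.ball 0 1, ‖u (r₃ • x)‖ₑ ^ (2 : ℝ)) ^ (1 - α) := by
  have h₃ : 0 < r₃ := h₁.trans_le h₁₃
  have h₂₃ : r₂ ≤ r₃ := by
    have := Real.log_le_log h₁ h₁₃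
    rw [← Real.log_le_log_iff h₂ h₃]
    nlinarith
  have hφ := fun j : ℕ => lintegral_radial_mul_le h₁ h₁₃ hu hα0 hα1 hr h₂ (continuous_cutoff j)
    (cutoff_nonneg j) (b := 1 - 1 / ((j : ℝ) + 2)) (by
      rw [sub_pos, div_lt_one (by positivity)]
      have : (0 : ℝ) ≤ j := j.cast_nonneg
      linarith) (sub_lt_self 1 (by positivity)) fun t ht => cutoff_eq_zero ht
  have hsup : ∀ (r : ℝ) (x : E),
      ⨆ j, ENNReal.ofReal (cutoff j (‖x‖ ^ 2)) * ‖u (r • x)‖ₑ ^ (2 : ℝ) =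
        (Metric.ball (0 : E) 1).indicator (fun x => ‖u (r • x)‖ₑ ^ (2 : ℝ)) x := by
    intro r x
    rw [← ENNReal.iSup_mul, iSup_ofReal_cutoff]
    have hiff : ‖x‖ ^ 2 < 1 ↔ x ∈ Metric.ball (0 : E) 1 := by
      rw [mem_ball_zero_iff, sq_lt_one_iff₀ (norm_nonneg x)]
    by_cases hx : x ∈ Metric.ball (0 : E) 1
    · rw [Set.indicator_of_mem hx, if_pos (hiff.2 hx), one_mul]
    · rw [Set.indicator_of_notMem hx, if_neg (mt hiff.1 hx), zero_mul]
  have hlim : ∀ r, 0 < r → r ≤ r₃ → ∫⁻ x in Metric.ball (0 : E) 1, ‖u (r • x)‖ₑ ^ (2 : ℝ) =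
      ⨆ j, ∫⁻ x : E, ENNReal.ofReal (cutoff j (‖x‖ ^ 2)) * ‖u (r • x)‖ₑ ^ (2 : ℝ) := by
    intro r hr0 hr3
    rw [← lintegral_indicator Metric.isOpen_ball.measurableSet,
      ← lintegral_iSup (fun j => (hφ j).1 r hr0 hr3)]
    · exact lintegral_congr fun x => (hsup r x).symm
    · intro i j hij x
      have := cutoff_mono (‖x‖ ^ 2) hij
      dsimp only at this ⊢
      gcongr
  rw [hlim r₂ h₂ h₂₃]
  refine iSup_le fun j => (hφ j).2.trans ?_
  rw [hlim r₁ h₁ h₁₃, hlim r₃ h₃ le_rfl]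
  have hα1' : 0 ≤ 1 - α := by linarith
  gcongr
  · exact le_iSup (fun j : ℕ => ∫⁻ x : E, ENNReal.ofReal (cutoff j (‖x‖ ^ 2)) *
      ‖u (r₁ • x)‖ₑ ^ (2 : ℝ)) j
  · exact le_iSup (fun j : ℕ => ∫⁻ x : E, ENNReal.ofReal (cutoff j (‖x‖ ^ 2)) *
      ‖u (r₃ • x)‖ₑ ^ (2 : ℝ)) j

theorem l2BallNorm_le_rpow_mul_rpow {n : ℕ} {F : Type*} [NormedAddCommGroup F]
    [InnerProductSpace ℝ F] {u : EuclideanSpace ℝ (Fin n) → F} {r₁ r₂ r₃ α : ℝ} (h₁ : 0 < r₁)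
    (h₁₃ : r₁ ≤ r₃) (hu : HarmonicOnNhd u (Metric.ball 0 r₃)) (hα0 : 0 < α) (hα1 : α < 1)
    (hr : Real.log r₂ = α * Real.log r₁ + (1 - α) * Real.log r₃) (h₂ : 0 < r₂) :
    l2BallNorm u r₂ ≤ l2BallNorm u r₁ ^ α * l2BallNorm u r₃ ^ (1 - α) := by
  have h₃ : 0 < r₃ := h₁.trans_le h₁₃
  have hα1' : 0 ≤ 1 - α := by linarith
  have hfac : ENNReal.ofReal (r₂ ^ ((n : ℝ) / 2)) =
      ENNReal.ofReal (r₁ ^ ((n : ℝ) / 2)) ^ α * ENNReal.ofReal (r₃ ^ ((n : ℝ) / 2)) ^ (1 - α) := by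
    rw [ENNReal.ofReal_rpow_of_pos (by positivity), ENNReal.ofReal_rpow_of_pos (by positivity),
      ← ENNReal.ofReal_mul (by positivity), ← Real.rpow_mul h₁.le, ← Real.rpow_mul h₃.le,
      Real.rpow_def_of_pos h₁, Real.rpow_def_of_pos h₂, Real.rpow_def_of_pos h₃, ← Real.exp_add, hr]
    congr 2
    ring
  rw [l2BallNorm_eq_mul_comp_smul u h₁, l2BallNorm_eq_mul_comp_smul u h₂,
    l2BallNorm_eq_mul_comp_smul u h₃, ENNReal.mul_rpow_of_nonneg _ _ hα0.le,
    ENNReal.mul_rpow_of_nonneg _ _ hα1', mul_mul_mul_comm, hfac]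
  gcongr
  simp only [l2BallNorm_eq]
  rw [← ENNReal.rpow_mul, ← ENNReal.rpow_mul, mul_comm _ α, mul_comm _ (1 - α), ENNReal.rpow_mul,
    ENNReal.rpow_mul, ← ENNReal.mul_rpow_of_nonneg _ _ (by norm_num)]
  gcongr
  exact setLIntegral_ball_le h₁ h₁₃ hu hα0 hα1 hr h₂

end ThreeBalls

/-! ### Sharpness of the exponent -/

section Sharpness

/-- `x ↦ x₁ + i x₂` as a real-linear map. -/
noncomputable def complexCoordinate {n : ℕ} (hn : 2 ≤ n) : EuclideanSpace ℝ (Fin n) →L[ℝ] ℂ :=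
  Complex.ofRealCLM ∘L EuclideanSpace.proj ⟨0, by omega⟩ +
    Complex.I • (Complex.ofRealCLM ∘L EuclideanSpace.proj ⟨1, by omega⟩)

theorem zPow_eq {n : ℕ} (hn : 2 ≤ n) (k : ℕ) :
    zPow hn k = (fun z : ℂ => z ^ k) ∘ complexCoordinate hn := by
  ext x
  simp [zPow, complexCoordinate]

/-- Harmonicity on the complex plane carries over, since the coordinate `x₁ + i x₂` maps the standard
basis to `1, i, 0, …, 0`. -/
theorem harmonicOnNhd_zPow {n : ℕ} (hn : 2 ≤ n) (k : ℕ) :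
    HarmonicOnNhd (zPow hn k) Set.univ := by
  have hf : ContDiff ℂ 2 fun z : ℂ => z ^ k := contDiff_id.pow k
  have hfR : ContDiff ℝ 2 fun z : ℂ => z ^ k := contDiff_id.pow k
  have hΔ : ∀ x, Laplacian.laplacian (zPow hn k) x = 0 := by
    intro x
    have h0 := hf.contDiffAt.harmonicAt (x := complexCoordinate hn x) |>.2.eq_of_nhds
    rw [laplacian_eq_iteratedFDeriv_complexPlane] at h0
    rw [zPow_eq, laplacian_eq_iteratedFDeriv_orthonormalBasis _ (EuclideanSpace.basisFun (Fin n) ℝ)]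
    have hb : ∀ i : Fin n, complexCoordinate hn (EuclideanSpace.basisFun (Fin n) ℝ i) =
        if i = ⟨0, by omega⟩ then 1 else if i = ⟨1, by omega⟩ then Complex.I else 0 := by
      intro i
      have h01 : (⟨0, by omega⟩ : Fin n) ≠ ⟨1, by omega⟩ := by simp
      split_ifs with hi0 hi1
      · subst hi0; simp [complexCoordinate]
      · subst hi1; simp [complexCoordinate]
      · simp [complexCoordinate, Ne.symm hi0, Ne.symm hi1]
    have hterm : ∀ i : Fin n, iteratedFDeriv ℝ 2 ((fun z : ℂ => z ^ k) ∘ complexCoordinate hn) x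
        ![EuclideanSpace.basisFun (Fin n) ℝ i, EuclideanSpace.basisFun (Fin n) ℝ i] =
        (if i = ⟨0, by omega⟩ then
          iteratedFDeriv ℝ 2 (fun z : ℂ => z ^ k) (complexCoordinate hn x) ![1, 1] else 0) +
        (if i = ⟨1, by omega⟩ then iteratedFDeriv ℝ 2 (fun z : ℂ => z ^ k) (complexCoordinate hn x)
          ![Complex.I, Complex.I] else 0) := by
      intro i
      rw [ContinuousLinearMap.iteratedFDeriv_comp_right _ hfR x le_rfl]
      simp only [iteratedFDeriv_two_apply, ContinuousMultilinearMap.compContinuousLinearMap_apply,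
        Matrix.cons_val_zero, Matrix.cons_val_one, hb]
      have h01 : (⟨1, by omega⟩ : Fin n) ≠ ⟨0, by omega⟩ := by simp
      by_cases hi0 : i = ⟨0, by omega⟩
      · simp [hi0]
      · by_cases hi1 : i = ⟨1, by omega⟩
        · simp [hi1]
        · simp [hi0, hi1]
    simp_rw [hterm]
    rw [Finset.sum_add_distrib, Finset.sum_ite_eq', Finset.sum_ite_eq']
    simpa using h0
  refine fun x _ => ⟨?_, .of_forall hΔ⟩
  rw [zPow_eq]
  exact (hfR.comp (complexCoordinate hn).contDiff).contDiffAt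

theorem zPow_smul {n : ℕ} (hn : 2 ≤ n) (k : ℕ) (r : ℝ) (x : EuclideanSpace ℝ (Fin n)) :
    zPow hn k (r • x) = (r : ℂ) ^ k * zPow hn k x := by
  rw [zPow_eq, Function.comp_apply, map_smul, Complex.real_smul, mul_pow]
  rfl

theorem zPow_single {n : ℕ} (hn : 2 ≤ n) (k : ℕ) (t : ℝ) :
    zPow hn k (EuclideanSpace.single ⟨0, by omega⟩ t) = (t : ℂ) ^ k := by
  simp [zPow]

theorem l2BallNorm_ne_top {n : ℕ} {F : Type*} [NormedAddCommGroup F]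
    {u : EuclideanSpace ℝ (Fin n) → F} (hu : Continuous u) (r : ℝ) : l2BallNorm u r ≠ ∞ := by
  obtain ⟨C, hC⟩ := (isCompact_closedBall (0 : EuclideanSpace ℝ (Fin n)) r).exists_bound_of_continuousOn
    hu.continuousOn
  have : IsFiniteMeasure (volume.restrict (Metric.ball (0 : EuclideanSpace ℝ (Fin n)) r)) :=
    ⟨by simpa using measure_ball_lt_top⟩
  refine (MemLp.of_bound (p := 2) hu.aestronglyMeasurable C ?_).eLpNorm_ne_top
  refine (ae_restrict_iff' Metric.isOpen_ball.measurableSet).2 (.of_forall fun x hx => ?_)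
  exact hC x (Metric.ball_subset_closedBall hx)

theorem l2BallNorm_ne_zero {n : ℕ} {F : Type*} [NormedAddCommGroup F]
    {u : EuclideanSpace ℝ (Fin n) → F} (hu : Continuous u) {r : ℝ}
    {x : EuclideanSpace ℝ (Fin n)} (hx : ‖x‖ < r) (hux : u x ≠ 0) : l2BallNorm u r ≠ 0 := by
  intro h
  rw [l2BallNorm, eLpNorm_eq_zero_iff hu.aestronglyMeasurable (by norm_num)] at h
  exact hux (Measure.eqOn_open_of_ae_eq h Metric.isOpen_ball hu.continuousOn continuousOn_const
    (by simpa using hx))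

/-- Homogeneous functions of large degree `k` detect the exponent: on balls of radius `r` their norm
is proportional to `r ^ (k + n / 2)`. -/
theorem exists_not_l2BallNorm_le {n : ℕ} {F : Type*} [NormedAddCommGroup F] [NormedSpace ℝ F]
    {u : ℕ → EuclideanSpace ℝ (Fin n) → F} (hu : ∀ k, Continuous (u k))
    (hhom : ∀ k (r : ℝ) x, u k (r • x) = r ^ k • u k x) {x : EuclideanSpace ℝ (Fin n)}
    (hx : ‖x‖ < 1) (hux : ∀ k, u k x ≠ 0) {r₁ r₂ r₃ α : ℝ} (h₁ : 0 < r₁) (h₂ : 0 < r₂) (h₃ : 0 < r₃)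
    (hr : α * Real.log r₁ + (1 - α) * Real.log r₃ < Real.log r₂) (C : ℝ≥0) :
    ∃ k, ¬ l2BallNorm (u k) r₂ ≤ C * (l2BallNorm (u k) r₁ ^ α * l2BallNorm (u k) r₃ ^ (1 - α)) := by
  by_contra! hle
  set δ := Real.log r₂ - (α * Real.log r₁ + (1 - α) * Real.log r₃) with hδ
  have hδ0 : 0 < δ := by linarith
  have hnorm : ∀ k, ∃ c : ℝ, 0 < c ∧ ∀ r, 0 < r →
      l2BallNorm (u k) r = ENNReal.ofReal (Real.exp (Real.log r * (k + (n : ℝ) / 2)) * c) := by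
    intro k
    have ht := l2BallNorm_ne_top (hu k) 1
    refine ⟨(l2BallNorm (u k) 1).toReal, ENNReal.toReal_pos (l2BallNorm_ne_zero (hu k) hx (hux k)) ht,
      fun r hr0 => ?_⟩
    have hsm : (fun x => u k (r • x)) = (r ^ k) • u k := by ext x; simp [hhom]
    have : l2BallNorm (fun x => u k (r • x)) 1 = ENNReal.ofReal (r ^ k) * l2BallNorm (u k) 1 := by
      rw [hsm, l2BallNorm, l2BallNorm, eLpNorm_const_smul, Real.enorm_of_nonneg (by positivity)]
    rw [l2BallNorm_eq_mul_comp_smul _ hr0, this, ENNReal.ofReal_mul (Real.exp_pos _).le,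
      ENNReal.ofReal_toReal ht, ← mul_assoc, ← ENNReal.ofReal_mul (by positivity),
      ← Real.rpow_natCast, ← Real.rpow_add hr0, ← Real.rpow_def_of_pos hr0, add_comm]
  have hbd : ∀ k : ℕ, Real.exp (δ * (k + (n : ℝ) / 2)) ≤ C := by
    intro k
    obtain ⟨c, hc, hcr⟩ := hnorm k
    have h := hle k
    rw [hcr r₁ h₁, hcr r₂ h₂, hcr r₃ h₃, ENNReal.ofReal_rpow_of_pos (by positivity),
      ENNReal.ofReal_rpow_of_pos (by positivity), ← ENNReal.ofReal_coe_nnreal,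
      ← ENNReal.ofReal_mul (by positivity), ← ENNReal.ofReal_mul (by positivity),
      ENNReal.ofReal_le_ofReal_iff (by positivity), Real.mul_rpow (by positivity) hc.le,
      Real.mul_rpow (by positivity) hc.le, mul_mul_mul_comm, ← Real.rpow_add hc,
      add_sub_cancel, Real.rpow_one, ← mul_assoc] at h
    have h := le_of_mul_le_mul_right h hc
    rw [← Real.exp_mul, ← Real.exp_mul, ← Real.exp_add, ← div_le_iff₀ (Real.exp_pos _),
      ← Real.exp_sub] at h
    refine le_trans (le_of_eq ?_) h
    congr 1
    rw [hδ]; ring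
  obtain ⟨k, hk⟩ := exists_nat_gt ((C : ℝ) / δ)
  have h1 := hbd k
  rw [div_lt_iff₀ hδ0] at hk
  have h2 := Real.add_one_le_exp (δ * (k + (n : ℝ) / 2))
  have h3 : 0 ≤ δ * ((n : ℝ) / 2) := by positivity
  nlinarith

end Sharpness

/-! ### The three balls theorem -/

theorem theorem1 (n : ℕ) (hn : n = 2 ∨ n = 3) (𝕜 : Type*) [RCLike 𝕜]
    (r₁ r₂ r₃ : ℝ) (h₁ : 0 < r₁) (h₁₂ : r₁ < r₂) (h₂₃ : r₂ < r₃)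
    (α β : ℝ)
    (hβ : β = (Real.log r₃ - Real.log r₂) / (Real.log r₂ - Real.log r₁))
    (hα : α = β / (1 + β)) :
    -- the closed form of the exponent
    α = (Real.log r₃ - Real.log r₂) / (Real.log r₃ - Real.log r₁) ∧
    -- the three-ball inequality with constant one, for every harmonic function on the largest ball
    (∀ u : EuclideanSpace ℝ (Fin n) → 𝕜, HarmonicOnNhd u (Metric.ball 0 r₃) →
      l2BallNorm u r₂ ≤ l2BallNorm u r₁ ^ α * l2BallNorm u r₃ ^ (1 - α)) ∧
    -- no larger exponent is possible with any constant, even for functions harmonic on all of space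
    (¬ ∃ α' : ℝ, α < α' ∧ ∃ C : ℝ≥0,
      ∀ u : EuclideanSpace ℝ (Fin n) → 𝕜, HarmonicOnNhd u Set.univ →
        l2BallNorm u r₂ ≤ C * (l2BallNorm u r₁ ^ α' * l2BallNorm u r₃ ^ (1 - α'))) ∧
    -- the complex harmonic polynomials `z ^ k` already witness this
    (∀ k : ℕ, HarmonicOnNhd (zPow (n := n) (by omega) k) Set.univ) ∧
    (∀ α' : ℝ, α < α' → ∀ C : ℝ≥0, ∃ k : ℕ,
      ¬ l2BallNorm (zPow (n := n) (by omega) k) r₂ ≤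
        C * (l2BallNorm (zPow (n := n) (by omega) k) r₁ ^ α' *
          l2BallNorm (zPow (n := n) (by omega) k) r₃ ^ (1 - α'))) := by
  have hn2 : 2 ≤ n := by omega
  have h₂ : 0 < r₂ := h₁.trans h₁₂
  have h₃ : 0 < r₃ := h₂.trans h₂₃
  have l₁₂ : Real.log r₁ < Real.log r₂ := Real.log_lt_log h₁ h₁₂
  have l₂₃ : Real.log r₂ < Real.log r₃ := Real.log_lt_log h₂ h₂₃
  have hform : α = (Real.log r₃ - Real.log r₂) / (Real.log r₃ - Real.log r₁) := by
    have h12 : Real.log r₂ - Real.log r₁ ≠ 0 := by linarith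
    have h13 : Real.log r₃ - Real.log r₁ ≠ 0 := by linarith
    have hsum : 1 + β = (Real.log r₃ - Real.log r₁) / (Real.log r₂ - Real.log r₁) := by
      rw [hβ]; field_simp; ring
    rw [hα, hsum, hβ]
    field_simp
  have hα0 : 0 < α := by rw [hform]; exact div_pos (by linarith) (by linarith)
  have hα1 : α < 1 := by rw [hform, div_lt_one (by linarith)]; linarith
  have hlog : Real.log r₂ = α * Real.log r₁ + (1 - α) * Real.log r₃ := by
    have h13 : Real.log r₃ - Real.log r₁ ≠ 0 := by linarith
    have : α * (Real.log r₃ - Real.log r₁) = Real.log r₃ - Real.log r₂ := by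
      rw [hform, div_mul_cancel₀ _ h13]
    linarith
  have hlt : ∀ α', α < α' → α' * Real.log r₁ + (1 - α') * Real.log r₃ < Real.log r₂ := by
    intro α' h
    nlinarith
  -- A point where no `z ^ k` vanishes.
  set x₀ : EuclideanSpace ℝ (Fin n) := EuclideanSpace.single ⟨0, by omega⟩ (1 / 2) with hx₀
  have hx₀1 : ‖x₀‖ < 1 := by rw [hx₀, PiLp.norm_single]; norm_num
  have hharm := harmonicOnNhd_zPow hn2
  have hcont : ∀ k, Continuous (zPow hn2 k) := fun k =>
    continuousOn_univ.1 (hharm k).continuousOn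
  refine ⟨hform, fun u hu => l2BallNorm_le_rpow_mul_rpow h₁ (h₁₂.trans h₂₃).le hu hα0 hα1 hlog h₂,
    ?_, hharm, fun α' h C => exists_not_l2BallNorm_le hcont (fun k r x => ?_) hx₀1 (fun k => ?_)
      h₁ h₂ h₃ (hlt α' h) C⟩
  · rintro ⟨α', h, C, hC⟩
    -- The functions `Re (z ^ k)` take values in every `𝕜`.
    let L : ℂ →L[ℝ] 𝕜 := RCLike.ofRealCLM ∘L Complex.reCLM
    obtain ⟨k, hk⟩ := exists_not_l2BallNorm_le (u := fun k => L ∘ zPow hn2 k)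
      (fun k => L.continuous.comp (hcont k))
      (fun k r x => by
        rw [Function.comp_apply, zPow_smul, ← Complex.ofReal_pow, ← Complex.real_smul, map_smul]
        rfl) hx₀1
      (fun k => by
        rw [Function.comp_apply, hx₀, zPow_single, ← Complex.ofReal_pow]
        change (((((1 / 2 : ℝ) ^ k : ℝ) : ℂ).re : ℝ) : 𝕜) ≠ 0
        rw [Complex.ofReal_re]
        exact RCLike.ofReal_ne_zero.2 (by positivity)) h₁ h₂ h₃ (hlt α' h) C
    exact hk (hC _ ((hharm k).comp_CLM L))
  · rw [zPow_smul, ← Complex.ofReal_pow, Complex.real_smul]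
  · rw [hx₀, zPow_single]
    simp
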